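/- Let $\mathbb T=\mathbb R/\mathbb Z$. The Bohr topology of $\mathbb Z$ is the weakest topology on $\mathbb Z$ making all homomorphisms $\mathbb Z\to\mathbb T$ continuous. For $A\subseteq\mathbb Z$ let $A-A=\{a-b: a,b\in A\}$, and let $$d^*(A)=\limsup_{n\to\infty}\ \sup_{k\in\mathbb Z}\frac{|A\cap\{k+1,\dots,k+n\}|}{n}$$ be its upper Banach density. For every $\varepsilon>0$ there are sets $S,A\subseteq\mathbb Z$ such that $S$ is dense in the Bohr topology of $\mathbb Z$, $d^*(A)>\frac12-\varepsilon$, and $(A-A)\cap S=\varnothing$. Consequently, there is a set $A\subseteq\mathbb Z$ with $d^*(A)>0$ such that, for every $n\in\mathbb Z$, the set $A-A$ contains no neighborhood of $n$ in the Bohr topology. This answers in the negative Ruzsa's question whether for every $A\subseteq\mathbb Z$ with $d^*(A)>0$ there is an $n\in\mathbb Z$ such that $A-A$ contains a Bohr neighborhood of $n$. -/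

import Mathlib

open scoped Pointwise

/-- The Bohr topology of `ℤ`: the weakest (coarsest) topology on `ℤ` for which every group
homomorphism from `ℤ` to the circle `ℝ / ℤ` is continuous. In Mathlib's order on topologies, this
is the infimum of the topologies induced by these homomorphisms. It is a plain definition and not
an instance, since `ℤ` already carries the discrete topology as an instance. -/
@[reducible] def bohrTopology : TopologicalSpace ℤ :=
  ⨅ φ : ℤ →+ UnitAddCircle, TopologicalSpace.induced φ inferInstance

/-- `S` is dense with respect to the Bohr topology. -/
def BohrDense (S : Set ℤ) : Prop :=
  @Dense ℤ bohrTopology S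

/-- `B` is a neighborhood of `n` with respect to the Bohr topology. -/
def IsBohrNhd (B : Set ℤ) (n : ℤ) : Prop :=
  B ∈ @nhds ℤ bohrTopology n

/-- The upper Banach density
`d*(A) = limsup_{n → ∞} sup_{k ∈ ℤ} |A ∩ {k+1, …, k+n}| / n`. All quotients lie in `[0, 1]`, so the
supremum and the limsup over the reals are the usual ones. -/
noncomputable def upperBanachDensity (A : Set ℤ) : ℝ :=
  Filter.limsup
    (fun n : ℕ => ⨆ k : ℤ, ((A ∩ Set.Icc (k + 1) (k + (n : ℤ))).ncard : ℝ) / (n : ℝ))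
    Filter.atTop

/-! The set `S` grows by finite pieces, each serving all Bohr neighborhoods of one centre `n` with
given rank and radius, while its elements stay avoidable in a finite rotation with density above a
fixed `d < 1/2`.

Let `A` in `(G, g)` avoid `S`, with `1 ∈ S` and `m = |G|`. Adjoin `r` coordinates, each carrying a
digit in `ZMod m`, and twist the `G`-coordinate by `F y • g`, where `F` is the plurality value of
the digits `y` (`exists_avoiding_extension`). Elements of `S` leave the digits fixed, so they still
move `A` off itself. A new element `t ≡ n` mod `m` adds `n - 1` to all but few digits. For most `y`
this adds `n - 1` to `F y` (`exists_robust_equivariant`), so after untwisting `t` acts as `n - (n -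
1) = 1`, which is already avoided.

Such `t` occur in every rank `k` Bohr neighborhood of `n`: given `k` frequencies, all but `k + 1` of
`r` rationally independent rotation numbers are independent modulo `1` and those frequencies, and
Kronecker's theorem applies (`exists_int_approx_off_few_coordinates`). Compactness makes finitely
many `t` suffice.

Finally, visit times to the finite sets, started so that every initial segment has density at least
`d`, have an ultrafilter limit that avoids the whole of `S`. -/

/-- `AvoidableWithDensity d S` says that some rotation of a finite abelian group has a set of
density greater than `d` which is disjoint from its translates by the elements of `S`. -/
def AvoidableWithDensity (d : ℝ) (S : Set ℤ) : Prop :=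
  ∃ (G : Type) (_ : AddCommGroup G) (_ : Fintype G) (g : G) (A : Finset G),
    d * Fintype.card G < A.card ∧ ∀ s ∈ S, ∀ a ∈ A, a + s • g ∉ A

/-! ### From finite rotations to sets of integers -/

/-- Start where the partial sums minus `d * z` are minimal over one period; this excess does not
decrease over a period, so the minimum is global. The bound holds for every `n` independently of
`m`, hence survives a limit in which the periods grow. -/
theorem exists_forall_le_sum_range_of_periodic {f : ℕ → ℝ} {m : ℕ} (hm : 0 < m) {d : ℝ}
    (hf : Function.Periodic f m) (hd : d * m ≤ ∑ i ∈ Finset.range m, f i) :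
    ∃ z : ℕ, ∀ n : ℕ, d * n ≤ ∑ i ∈ Finset.range n, f (z + i) := by
  set h : ℕ → ℝ := fun z => ∑ i ∈ Finset.range z, f i - d * z with h_def
  have hstep : ∀ z, h z ≤ h (z + m) := by
    intro z
    have h1 : ∑ i ∈ Finset.range (z + m), f i =
        ∑ i ∈ Finset.range z, f i + ∑ i ∈ Finset.range m, f i := by
      rw [add_comm z m, Finset.sum_range_add, add_comm]
      congr 1
      exact Finset.sum_congr rfl fun i _ => by rw [add_comm]; exact hf i
    simp only [h_def, h1]
    push_cast
    linarith
  have hmod : ∀ z, h (z % m) ≤ h z := by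
    intro z
    have : ∀ k a, h a ≤ h (a + m * k) := by
      intro k a
      induction k with
      | zero => simp
      | succ k ih =>
        refine ih.trans ((hstep _).trans (le_of_eq ?_))
        congr 1
        ring
    calc h (z % m) ≤ h (z % m + m * (z / m)) := this _ _
      _ = h z := by rw [Nat.mod_add_div]
  obtain ⟨z, -, hz⟩ := Finset.exists_min_image (Finset.range m) h ⟨0, by simpa using hm⟩
  refine ⟨z, fun n => ?_⟩
  have h1 : h z ≤ h (z + n) :=
    (hz _ (Finset.mem_range.2 (Nat.mod_lt _ hm))).trans (hmod _)
  simp only [h_def, Finset.sum_range_add] at h1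
  push_cast at h1
  linarith

theorem AvoidableWithDensity.exists_set {d : ℝ} {S : Set ℤ} (h : AvoidableWithDensity d S) :
    ∃ A : Set ℤ, (∀ s ∈ S, ∀ a ∈ A, a + s ∉ A) ∧
      ∀ n : ℕ, d * n ≤ ((A ∩ Set.Icc 1 (n : ℤ)).ncard : ℝ) := by
  classical
  obtain ⟨G, _, _, g, A, hd, hA⟩ := h
  set m := Fintype.card G with m_def
  have hm : 0 < m := Fintype.card_pos
  have hmg : m • g = 0 := card_nsmul_eq_zero
  let f : G → ℕ → ℝ := fun x i => if x + i • g ∈ A then 1 else 0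
  obtain ⟨x, hx⟩ : ∃ x, d * m ≤ ∑ i ∈ Finset.range m, f x i := by
    by_contra! hcon
    have h1 : ∑ x, ∑ i ∈ Finset.range m, f x i = m * A.card := by
      rw [Finset.sum_comm]
      have : ∀ i ∈ Finset.range m, ∑ x, f x i = A.card := by
        intro i _
        rw [Fintype.sum_equiv (Equiv.addRight (i • g)) (fun x => f x i)
          (fun x => if x ∈ A then 1 else 0) (fun x => rfl)]
        simp
      rw [Finset.sum_congr rfl this]
      simp
    have h2 : ∑ x, ∑ i ∈ Finset.range m, f x i ≤ ∑ _x : G, d * m :=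
      Finset.sum_le_sum fun x _ => (hcon x).le
    rw [h1, Finset.sum_const, Finset.card_univ, nsmul_eq_mul, ← m_def] at h2
    have : (0 : ℝ) < m := by exact_mod_cast hm
    nlinarith
  have hper : Function.Periodic (f x) m := by
    intro i
    simp [f, add_smul, hmg]
  obtain ⟨z, hz⟩ := exists_forall_le_sum_range_of_periodic hm hper hx
  -- The shift by one matches sums over `0, …, n - 1` with the window `{1, …, n}`.
  refine ⟨{k : ℤ | x + ((z : ℤ) + (k - 1)) • g ∈ A}, fun s hs a ha hmem => ?_, fun n => ?_⟩
  · refine hA s hs _ ha ?_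
    have : x + ((z : ℤ) + (a + s - 1)) • g = x + ((z : ℤ) + (a - 1)) • g + s • g := by
      rw [add_assoc, ← add_smul]
      congr 2
      ring
    simpa [this] using hmem
  · refine (hz n).trans ?_
    simp only [f, Finset.sum_boole, Nat.cast_le]
    rw [← Set.ncard_coe_finset]
    refine Set.ncard_le_ncard_of_injOn (fun i : ℕ => (i : ℤ) + 1) ?_ ?_
      ((Set.finite_Icc _ _).inter_of_right _)
    · intro i hi
      simp only [Finset.coe_filter, Finset.mem_range, Set.mem_ofPred_eq] at hi
      refine ⟨?_, ?_⟩
      · have : ((z : ℤ) + ((i : ℤ) + 1 - 1)) = ((z + i : ℕ) : ℤ) := by push_cast; ring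
        simp only [Set.mem_ofPred_eq]
        rw [this, natCast_zsmul]
        exact hi.2
      · simp only [Set.mem_Icc]
        omega
    · intro i _ j _ hij
      simpa using hij

theorem exists_set_of_monotone_avoidable {d : ℝ} {S : ℕ → Set ℤ} (hS : Monotone S)
    (h : ∀ j, AvoidableWithDensity d (S j)) :
    ∃ A : Set ℤ, (∀ s ∈ ⋃ j, S j, ∀ a ∈ A, a + s ∉ A) ∧
      ∀ n : ℕ, d * n ≤ ((A ∩ Set.Icc 1 (n : ℤ)).ncard : ℝ) := by
  classical
  choose A hA hd using fun j => (h j).exists_set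
  let U : Filter ℕ := Filter.hyperfilter ℕ
  refine ⟨{x | ∀ᶠ j in U, x ∈ A j}, ?_, fun n => ?_⟩
  · intro s hs a ha has
    obtain ⟨i, hi⟩ := Set.mem_iUnion.1 hs
    have hle : ∀ᶠ j in U, i ≤ j :=
      (Filter.hyperfilter_le_cofinite.trans Nat.cofinite_eq_atTop.le) (Filter.eventually_ge_atTop i)
    simp only [Set.mem_ofPred_eq] at ha has
    obtain ⟨j, ⟨h1, h2⟩, h3⟩ := ((ha.and has).and hle).exists
    exact hA j s (hS h3 hi) a h1 h2
  -- Only finitely many points matter, so a single `j` has all of `A j ∩ [1, n]` inside the limit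
  -- set.
  · have key : ∀ x ∈ Finset.Icc (1 : ℤ) n, ∀ᶠ j in U,
        (x ∈ A j → ∀ᶠ j in U, x ∈ A j) := by
      intro x _
      by_cases hx : ∀ᶠ j in U, x ∈ A j
      · exact Filter.Eventually.of_forall fun _ _ => hx
      · have : ∀ᶠ j in U, x ∉ A j := Ultrafilter.eventually_not.2 hx
        exact this.mono fun j h1 h2 => absurd h2 h1
    obtain ⟨j, hj⟩ := ((Filter.eventually_all_finset _).2 key).exists
    refine (hd j n).trans (Nat.cast_le.2 (Set.ncard_le_ncard ?_
      ((Set.finite_Icc _ _).inter_of_right _)))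
    rintro x ⟨hx, hxn⟩
    exact ⟨hj x (by simpa using hxn) hx, hxn⟩

theorem le_upperBanachDensity {d : ℝ} {A : Set ℤ}
    (h : ∀ n : ℕ, d * n ≤ ((A ∩ Set.Icc 1 (n : ℤ)).ncard : ℝ)) : d ≤ upperBanachDensity A := by
  have hle : ∀ (n : ℕ) (k : ℤ),
      ((A ∩ Set.Icc (k + 1) (k + (n : ℤ))).ncard : ℝ) / (n : ℝ) ≤ 1 := by
    intro n k
    refine div_le_one_of_le₀ ?_ (Nat.cast_nonneg _)
    have h1 : (A ∩ Set.Icc (k + 1) (k + (n : ℤ))).ncard ≤ (Set.Icc (k + 1) (k + (n : ℤ))).ncard :=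
      Set.ncard_le_ncard Set.inter_subset_right (Set.finite_Icc _ _)
    have h2 : (Set.Icc (k + 1) (k + (n : ℤ))).ncard = n := by
      rw [← Finset.coe_Icc, Set.ncard_coe_finset, Int.card_Icc]
      omega
    exact_mod_cast h2 ▸ h1
  refine Filter.le_limsup_of_frequently_le (Filter.Eventually.frequently ?_)
    ⟨1, Filter.eventually_map.2 (Filter.Eventually.of_forall fun n => ciSup_le (hle n))⟩
  filter_upwards [Filter.eventually_gt_atTop 0] with n hn
  refine le_trans ?_ (le_ciSup ⟨1, Set.forall_mem_range.2 (hle n)⟩ 0)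
  rw [le_div_iff₀ (by exact_mod_cast hn)]
  simpa using h n

/-! ### Kronecker's theorem -/

-- For a single character the sum is geometric, hence bounded, unless the character is trivial at
-- `g`; then it is trivial at `p` too and every term vanishes.
open Filter Topology UnitAddTorus in
theorem tendsto_average_of_mem_span_mFourier {ι : Type*} [Fintype ι] {g p : UnitAddTorus ι}
    (h : ∀ J : ι → ℤ, ∑ i, J i • g i = 0 → ∑ i, J i • p i = 0) {P : C(UnitAddTorus ι, ℂ)}
    (hP : P ∈ Submodule.span ℂ (Set.range (mFourier (d := ι)))) :
    Tendsto (fun N : ℕ => (∑ s ∈ Finset.range N, (P (p + s • g) - P (s • g))) / (N : ℂ))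
      atTop (𝓝 0) := by
  have happ : ∀ (J : ι → ℤ) (x : UnitAddTorus ι),
      mFourier J x = ((∑ i, J i • x i).toCircle : ℂ) := by
    intro J x
    simp only [mFourier, ContinuousMap.coe_mk, fourier_apply]
    induction (Finset.univ : Finset ι) using Finset.cons_induction with
    | empty => simp
    | cons a s ha ih => rw [Finset.prod_cons, Finset.sum_cons, AddCircle.toCircle_add, ih]; simp
  have hadd : ∀ (J : ι → ℤ) (x y : UnitAddTorus ι),
      mFourier J (x + y) = mFourier J x * mFourier J y := by
    intro J x y
    simp [happ, smul_add, Finset.sum_add_distrib, AddCircle.toCircle_add]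
  have hpow : ∀ (J : ι → ℤ) (x : UnitAddTorus ι) (s : ℕ),
      mFourier J (s • x) = mFourier J x ^ s := by
    intro J x s
    induction s with
    | zero => simp [happ]
    | succ s ih => rw [succ_nsmul, hadd, ih, pow_succ]
  induction hP using Submodule.span_induction with
  | mem P hP =>
    obtain ⟨J, rfl⟩ := hP
    simp only [hadd, hpow, ← sub_one_mul, ← Finset.mul_sum]
    by_cases hg : mFourier J g = 1
    · have : mFourier J p = 1 := by
        rw [happ] at hg ⊢
        rw [h J]
        · simp
        · refine AddCircle.injective_toCircle one_ne_zero ?_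
          rw [AddCircle.toCircle_zero]
          exact Circle.ext (by rw [hg, Circle.coe_one])
      simp [this]
    · have hb : ∀ N : ℕ, ‖(mFourier J p - 1) * ∑ s ∈ Finset.range N, mFourier J g ^ s‖ ≤
          2 * (2 / ‖mFourier J g - 1‖) := by
        intro N
        have h1 : ∀ x, ‖mFourier J x‖ = 1 := fun x => by rw [happ]; exact Circle.norm_coe _
        rw [geom_sum_eq hg, norm_mul, norm_div]
        have h2 : ∀ z : ℂ, ‖z‖ = 1 → ‖z - 1‖ ≤ 2 := fun z hz =>
          (norm_sub_le _ _).trans (by rw [hz]; norm_num)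
        gcongr
        · exact h2 _ (h1 p)
        · exact h2 _ (by rw [norm_pow, h1, one_pow])
      refine squeeze_zero_norm (a := fun N : ℕ => 2 * (2 / ‖mFourier J g - 1‖) / (N : ℝ))
        (fun N => ?_) (tendsto_const_div_atTop_nhds_zero_nat _)
      rw [norm_div, Complex.norm_natCast]
      gcongr
      exact hb N
  | zero => simp
  | add P Q _ _ hP hQ =>
    have hPQ := hP.add hQ
    rw [add_zero] at hPQ
    refine hPQ.congr fun N => ?_
    rw [← add_div, ← Finset.sum_add_distrib]
    congr 1
    refine Finset.sum_congr rfl fun s _ => ?_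
    simp only [ContinuousMap.add_apply]
    ring
  | smul c P _ hP =>
    have hcP := hP.const_mul c
    rw [mul_zero] at hcP
    refine hcP.congr fun N => ?_
    rw [← mul_div_assoc, Finset.mul_sum]
    simp [mul_sub]

open Filter Topology UnitAddTorus in
/-- **Kronecker's theorem**. -/
theorem mem_closure_zmultiples_of_forall_character {ι : Type*} [Fintype ι] {g p : UnitAddTorus ι}
    (h : ∀ J : ι → ℤ, ∑ i, J i • g i = 0 → ∑ i, J i • p i = 0) :
    p ∈ closure (AddSubgroup.zmultiples g : Set (UnitAddTorus ι)) := by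
  by_contra hp
  set H : Set (UnitAddTorus ι) := (AddSubgroup.zmultiples g : Set (UnitAddTorus ι)) with H_def
  have hne : H.Nonempty := ⟨0, zero_mem _⟩
  set D := Metric.infDist p H with D_def
  have hD : 0 < D := by
    rw [D_def, ← Metric.infDist_closure]
    exact (isClosed_closure.notMem_iff_infDist_pos hne.closure).1 hp
  -- The distance to the orbit separates the two averages: it is `D` along `p + s • g` and `0` along
  -- `s • g`. A trigonometric polynomial within `D / 4` keeps a gap of `D / 2`, against the equality
  -- of its averages in the limit.
  have hinv : ∀ s : ℕ, Metric.infDist (p + s • g) H = D := by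
    intro s
    have hs : s • g ∈ AddSubgroup.zmultiples g := nsmul_mem (AddSubgroup.mem_zmultiples g) s
    apply le_antisymm
    · refine (Metric.le_infDist hne).2 fun y hy => ?_
      refine (Metric.infDist_le_dist_of_mem (add_mem hy hs : y + s • g ∈ H)).trans ?_
      rw [dist_add_right]
    · refine (Metric.le_infDist hne).2 fun y hy => ?_
      refine (Metric.infDist_le_dist_of_mem (sub_mem hy hs : y - s • g ∈ H)).trans ?_
      rw [← dist_add_right _ _ (s • g), sub_add_cancel]
  let f : C(UnitAddTorus ι, ℂ) :=
    ⟨fun x => (Metric.infDist x H : ℂ), Complex.continuous_ofReal.comp (Metric.continuous_infDist_pt H)⟩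
  have hf : f ∈ closure (Submodule.span ℂ (Set.range (mFourier (d := ι))) : Set _) := by
    rw [← Submodule.topologicalClosure_coe, span_mFourier_closure_eq_top]
    trivial
  obtain ⟨P, hP, hfP⟩ := Metric.mem_closure_iff.1 hf (D / 4) (by positivity)
  have hclose : ∀ x, ‖f x - P x‖ ≤ D / 4 := fun x => by
    rw [← dist_eq_norm]
    exact (ContinuousMap.dist_apply_le_dist x).trans hfP.le
  have hlow : ∀ s : ℕ, D / 2 ≤ (P (p + s • g) - P (s • g)).re := by
    intro s
    have h1 := (Complex.abs_re_le_norm _).trans (hclose (p + s • g))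
    have h2 := (Complex.abs_re_le_norm _).trans (hclose (s • g))
    have h3 : f (p + s • g) = (D : ℂ) := by simp [f, hinv]
    have h4 : f (s • g) = 0 := by
      simp only [f, ContinuousMap.coe_mk, Complex.ofReal_eq_zero]
      exact Metric.infDist_zero_of_mem (nsmul_mem (AddSubgroup.mem_zmultiples g) s)
    rw [h3, abs_le] at h1
    rw [h4, abs_le] at h2
    simp only [Complex.sub_re, Complex.ofReal_re, Complex.zero_re] at *
    linarith [h1.2, h2.1]
  have hlim := (Complex.continuous_re.tendsto 0).comp (tendsto_average_of_mem_span_mFourier h hP)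
  have : D / 2 ≤ (0 : ℂ).re := by
    refine ge_of_tendsto hlim ?_
    filter_upwards [eventually_gt_atTop 0] with N hN
    have hN' : (0 : ℝ) < N := by exact_mod_cast hN
    simp only [Function.comp_apply]
    rw [Complex.div_natCast_re, le_div_iff₀ hN', Complex.re_sum]
    calc D / 2 * N = ∑ _s ∈ Finset.range N, D / 2 := by simp [mul_comm]
      _ ≤ _ := Finset.sum_le_sum fun s _ => hlow s
  simp only [Complex.zero_re] at this
  linarith

/-! ### Approximation off a few coordinates -/

/-- Rank-nullity: passing to the quotient by `W` lowers the rank of the family by at most `finrank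
W`. -/
theorem exists_linearIndependent_comp_mkQ {ι V : Type*} [Fintype ι] [AddCommGroup V] [Module ℚ V]
    {α : ι → V} (hα : LinearIndependent ℚ α) (W : Submodule ℚ V) [FiniteDimensional ℚ W] :
    ∃ I : Finset ι, Fintype.card ι ≤ I.card + Module.finrank ℚ W ∧
      LinearIndependent ℚ (fun i : I => W.mkQ (α i)) := by
  classical
  obtain ⟨κ, a, ha, hspan, hli⟩ := exists_linearIndependent' ℚ (W.mkQ ∘ α)
  have : Fintype κ := Fintype.ofInjective a ha
  refine ⟨Finset.univ.image a, ?_, ?_⟩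
  · rw [Finset.card_image_of_injective _ ha, Finset.card_univ]
    set M := Submodule.span ℚ (Set.range α) with M_def
    have : FiniteDimensional ℚ M := FiniteDimensional.span_of_finite ℚ (Set.finite_range α)
    have h1 : Module.finrank ℚ M = Fintype.card ι := finrank_span_eq_card hα
    have h2 : Module.finrank ℚ (M.map W.mkQ) = Fintype.card κ := by
      rw [M_def, Submodule.map_span, ← Set.range_comp, ← hspan]
      exact finrank_span_eq_card hli
    have h3 := LinearMap.finrank_range_add_finrank_ker (W.mkQ.domRestrict M)
    rw [LinearMap.range_domRestrict, h2, h1] at h3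
    have h4 : Module.finrank ℚ (LinearMap.ker (W.mkQ.domRestrict M)) ≤ Module.finrank ℚ W := by
      let e : LinearMap.ker (W.mkQ.domRestrict M) →ₗ[ℚ] W :=
        (M.subtype.domRestrict _).codRestrict W fun x => by
          exact (Submodule.Quotient.mk_eq_zero W).1 (LinearMap.mem_ker.1 x.2)
      refine LinearMap.finrank_le_finrank_of_injective (f := e) fun x y hxy => ?_
      apply Subtype.ext
      apply Subtype.ext
      exact congrArg (fun z : W => (z : V)) hxy
    omega
  · have hinj : ∀ i : (Finset.univ.image a), ∃ k, a k = i := fun i => by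
      obtain ⟨k, -, hk⟩ := Finset.mem_image.1 i.2
      exact ⟨k, hk⟩
    choose k hk using hinj
    have hk' : Function.Injective k := fun i j hij => by
      apply Subtype.ext
      rw [← hk i, ← hk j, hij]
    have h1 : (fun i : (Finset.univ.image a) => W.mkQ (α i)) = ((W.mkQ ∘ α) ∘ a) ∘ k := by
      ext i
      simp [hk]
    rw [h1]
    exact hli.comp k hk'

theorem exists_int_approx_off_few_coordinates {r k m : ℕ} (hm : 0 < m) {α : Fin r → ℝ}
    (hα : LinearIndependent ℚ α) (p : Fin r → UnitAddCircle) (β : Fin k → UnitAddCircle)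
    {δ : ℝ} (hδ : 0 < δ) :
    ∃ (s : ℤ) (I : Finset (Fin r)), Iᶜ.card ≤ k + 1 ∧
      (∀ i ∈ I, ‖((m * s * α i : ℝ) : UnitAddCircle) - p i‖ < δ) ∧
      ∀ j, ‖(m * s) • β j‖ < δ := by
  classical
  have hb : ∀ j, ∃ b : ℝ, (b : UnitAddCircle) = β j := fun j => QuotientAddGroup.mk_surjective _
  choose b hb using hb
  let v : Option (Fin k) → ℝ := fun o => o.elim 1 b
  set W := Submodule.span ℚ (Set.range v) with W_def
  have : FiniteDimensional ℚ W := FiniteDimensional.span_of_finite ℚ (Set.finite_range v)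
  obtain ⟨I, hI, hli⟩ := exists_linearIndependent_comp_mkQ hα W
  have hW : Module.finrank ℚ W ≤ k + 1 := by
    have := finrank_range_le_card (R := ℚ) v
    rwa [Fintype.card_option, Fintype.card_fin] at this
  let g : UnitAddTorus (I ⊕ Fin k) := Sum.elim (fun i => ((m * α i : ℝ) : UnitAddCircle))
    (fun j => m • β j)
  let q : UnitAddTorus (I ⊕ Fin k) := Sum.elim (fun i => p i) 0
  have hq : q ∈ closure (AddSubgroup.zmultiples g : Set (UnitAddTorus (I ⊕ Fin k))) := by
    refine mem_closure_zmultiples_of_forall_character fun J hJ => ?_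
    have hreal : ((∑ i : I, (J (Sum.inl i) : ℝ) * (m * α i) +
        ∑ j, (J (Sum.inr j) : ℝ) * (m * b j) : ℝ) : UnitAddCircle) = 0 := by
      have hsum : ∀ {κ : Type} [Fintype κ] (f : κ → ℝ),
          ((∑ i, f i : ℝ) : UnitAddCircle) = ∑ i, (f i : UnitAddCircle) := fun f =>
        map_sum (QuotientAddGroup.mk' (AddSubgroup.zmultiples (1 : ℝ))) f _
      rw [← hJ, Fintype.sum_sum_type, AddCircle.coe_add, hsum, hsum]
      congr 1
      · refine Finset.sum_congr rfl fun i _ => ?_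
        rw [← zsmul_eq_mul, AddCircle.coe_zsmul]
        rfl
      · refine Finset.sum_congr rfl fun j _ => ?_
        rw [← zsmul_eq_mul, AddCircle.coe_zsmul, ← nsmul_eq_mul, AddCircle.coe_nsmul, hb]
        rfl
    rw [AddCircle.coe_eq_zero_iff] at hreal
    obtain ⟨z, hz⟩ := hreal
    -- A character killing `g` puts a combination of the `α i`, `i ∈ I`, into `W`, so its
    -- coefficients there vanish; on the remaining coordinates the target is `0`.
    have hJ0 : ∀ i : I, J (Sum.inl i) = 0 := by
      have h1 : ∑ i : I, ((J (Sum.inl i) : ℚ) * m) • W.mkQ (α i) = 0 := by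
        have h2 : ∑ i : I, ((J (Sum.inl i) : ℚ) * m) • α i ∈ W := by
          have h3 : ∑ i : I, ((J (Sum.inl i) : ℚ) * m) • α i =
              (z : ℚ) • v none - ∑ j, ((J (Sum.inr j) : ℚ) * m) • v (some j) := by
            simp only [v, Option.elim, Rat.smul_def]
            push_cast
            simp only [mul_assoc, mul_one, zsmul_eq_mul] at hz ⊢
            linarith
          rw [h3]
          exact sub_mem (W.smul_mem _ (Submodule.subset_span ⟨_, rfl⟩))
            (sum_mem fun j _ => W.smul_mem _ (Submodule.subset_span ⟨_, rfl⟩))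
        rw [← (Submodule.Quotient.mk_eq_zero W)] at h2
        rw [← h2]
        simp [← Submodule.mkQ_apply]
      intro i
      have h2 := Fintype.linearIndependent_iff.1 hli _ h1 i
      have : (m : ℚ) ≠ 0 := by exact_mod_cast hm.ne'
      simpa [this] using h2
    simp [Fintype.sum_sum_type, q, hJ0]
  obtain ⟨y, ⟨s, rfl⟩, hy⟩ := Metric.mem_closure_iff.1 hq δ hδ
  rw [dist_pi_lt_iff hδ] at hy
  refine ⟨s, I, ?_, fun i hi => ?_, fun j => ?_⟩
  · rw [Finset.card_compl]
    omega
  · have := hy (Sum.inl ⟨i, hi⟩)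
    rw [dist_comm, dist_eq_norm] at this
    simp only [q, g, Sum.elim_inl, Pi.smul_apply] at this
    have h1 : ((m * s * α i : ℝ) : UnitAddCircle) = s • ((m * α i : ℝ) : UnitAddCircle) := by
      rw [← AddCircle.coe_zsmul, zsmul_eq_mul]
      congr 1
      ring
    rw [h1]
    exact this
  · have := hy (Sum.inr j)
    rw [dist_comm, dist_eq_norm] at this
    simp only [q, g, Sum.elim_inr, Pi.smul_apply, Pi.zero_apply, sub_zero] at this
    rwa [mul_comm, mul_smul, natCast_zsmul]

/-! ### Stability of the plurality vote -/

theorem card_filter_sum_eq_mul {Z : Type*} [Fintype Z] {q : ℕ} [NeZero q] (w : Z → ZMod q)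
    (r : ℕ) (t : ZMod q) :
    (((Finset.univ.filter fun y : Fin r → Z => ∑ i, w (y i) = t).card * q : ℕ) : ℂ) =
      ∑ ψ : AddChar (ZMod q) ℂ, ψ (-t) * (∑ z, ψ (w z)) ^ r := by
  classical
  have hprod : ∀ (ψ : AddChar (ZMod q) ℂ) (y : Fin r → Z),
      ∏ i, ψ (w (y i)) = ψ (∑ i, w (y i)) := by
    intro ψ y
    induction (Finset.univ : Finset (Fin r)) using Finset.cons_induction with
    | empty => simp
    | cons a s ha ih => rw [Finset.prod_cons, Finset.sum_cons, AddChar.map_add_eq_mul, ih]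
  calc (((Finset.univ.filter fun y : Fin r → Z => ∑ i, w (y i) = t).card * q : ℕ) : ℂ)
      = ∑ y : Fin r → Z, if ∑ i, w (y i) = t then (q : ℂ) else 0 := by
        rw [← Finset.sum_filter]
        simp
    _ = ∑ y : Fin r → Z, ∑ ψ : AddChar (ZMod q) ℂ, ψ (-t + ∑ i, w (y i)) := by
        refine Finset.sum_congr rfl fun y _ => ?_
        rw [AddChar.sum_apply_eq_ite, ZMod.card]
        simp only [neg_add_eq_zero, eq_comm (a := t)]
    _ = _ := by
        rw [Finset.sum_comm]
        refine Finset.sum_congr rfl fun ψ _ => ?_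
        simp only [Fintype.sum_pow, hprod, AddChar.map_add_eq_mul, Finset.mul_sum]

/-- A unit generates `ZMod q`, so a nontrivial `ψ` separates `w a` from `w b`, and the triangle
inequality is strict. -/
theorem norm_sum_addChar_lt_card {Z : Type*} [Fintype Z] {q : ℕ} [NeZero q] {w : Z → ZMod q}
    {a b : Z} (hab : IsUnit (w a - w b)) {ψ : AddChar (ZMod q) ℂ} (hψ : ψ ≠ 0) :
    ‖∑ z, ψ (w z)‖ < Fintype.card Z := by
  classical
  have hn : ∀ t, ‖ψ t‖ = 1 := fun t => ψ.norm_apply t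
  have hne : ψ (w a) ≠ ψ (w b) := by
    intro h
    apply hψ
    obtain ⟨u, hu⟩ := hab
    have h1 : ψ u = 1 := by
      rw [hu, AddChar.map_sub_eq_div, h, div_self]
      exact norm_ne_zero_iff.1 (by rw [hn]; exact one_ne_zero)
    ext t
    have h2 : t = (t * ↑u⁻¹ : ZMod q).val • (u : ZMod q) := by
      rw [nsmul_eq_mul, ZMod.natCast_zmod_val, mul_assoc, Units.inv_mul, mul_one]
    rw [h2, AddChar.map_nsmul_eq_pow, h1, one_pow, AddChar.zero_apply]
  have hab' : a ≠ b := fun h => hne (by rw [h])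
  have h2 : ‖ψ (w a) + ψ (w b)‖ < 2 := by
    refine lt_of_le_of_ne ((norm_add_le _ _).trans (by rw [hn, hn]; norm_num)) fun h => ?_
    refine hne (eq_of_norm_eq_of_norm_add_eq (by rw [hn, hn]) ?_)
    rw [h, hn, hn]
    norm_num
  rw [← Finset.add_sum_erase _ _ (Finset.mem_univ a),
    ← Finset.add_sum_erase _ _ (Finset.mem_erase.2 ⟨hab'.symm, Finset.mem_univ b⟩), ← add_assoc]
  have h3 : ‖∑ z ∈ (Finset.univ.erase a).erase b, ψ (w z)‖ ≤ (Fintype.card Z : ℝ) - 2 := by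
    refine (norm_sum_le _ _).trans (le_of_eq ?_)
    simp only [hn, Finset.sum_const, nsmul_eq_mul, mul_one]
    have hc : ((Finset.univ.erase a).erase b).card + 1 + 1 = Fintype.card Z := by
      rw [Finset.card_erase_add_one (Finset.mem_erase.2 ⟨hab'.symm, Finset.mem_univ b⟩),
        Finset.card_erase_add_one (Finset.mem_univ a), Finset.card_univ]
    rw [← hc]
    push_cast
    ring
  exact (norm_add_le _ _).trans_lt (by linarith)

-- The trivial character contributes the proportion `1 / q`; the others decay geometrically in `r`
-- and are eventually at most as large in total.
open Filter Topology in
theorem eventually_card_filter_sum_eq_le {Z : Type*} [Fintype Z] {q : ℕ} [NeZero q]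
    {w : Z → ZMod q} {a b : Z} (hab : IsUnit (w a - w b)) :
    ∀ᶠ r : ℕ in atTop, ∀ t : ZMod q,
      ((Finset.univ.filter fun y : Fin r → Z => ∑ i, w (y i) = t).card : ℝ) ≤
        2 / q * (Fintype.card Z : ℝ) ^ r := by
  classical
  have hZ : (0 : ℝ) < Fintype.card Z := by
    have : 0 < Fintype.card Z := Fintype.card_pos_iff.2 ⟨a⟩
    exact_mod_cast this
  have hq : (0 : ℝ) < q := by exact_mod_cast Nat.pos_of_ne_zero (NeZero.ne q)
  have hlim : Tendsto (fun r : ℕ => ∑ ψ ∈ (Finset.univ : Finset (AddChar (ZMod q) ℂ)).erase 0,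
      (‖∑ z, ψ (w z)‖ / Fintype.card Z) ^ r) atTop (𝓝 0) := by
    have h0 : ∑ ψ ∈ (Finset.univ : Finset (AddChar (ZMod q) ℂ)).erase 0, (0 : ℝ) = 0 :=
      Finset.sum_const_zero
    rw [← h0]
    refine tendsto_finsetSum _ fun ψ hψ =>
      tendsto_pow_atTop_nhds_zero_of_lt_one (r := ‖∑ z, ψ (w z)‖ / Fintype.card Z)
        (by positivity) ?_
    rw [div_lt_one hZ]
    exact norm_sum_addChar_lt_card hab (Finset.ne_of_mem_erase hψ)
  filter_upwards [hlim.eventually (gt_mem_nhds one_pos)] with r hr t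
  have h1 := congrArg norm (card_filter_sum_eq_mul w r t)
  rw [Complex.norm_natCast] at h1
  have h2 : ((((Finset.univ.filter fun y : Fin r → Z => ∑ i, w (y i) = t).card * q : ℕ)) : ℝ) ≤
      2 * (Fintype.card Z : ℝ) ^ r := by
    rw [h1]
    refine (norm_sum_le _ _).trans ?_
    simp only [norm_mul, AddChar.norm_apply, one_mul, norm_pow]
    rw [← Finset.add_sum_erase _ _ (Finset.mem_univ 0)]
    have h3 : ∑ ψ ∈ (Finset.univ : Finset (AddChar (ZMod q) ℂ)).erase 0, ‖∑ z, ψ (w z)‖ ^ r ≤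
        (Fintype.card Z : ℝ) ^ r := by
      simp only [div_pow, ← Finset.sum_div] at hr
      rw [div_lt_one (by positivity)] at hr
      exact hr.le
    simp only [AddChar.zero_apply, Finset.sum_const, Finset.card_univ, nsmul_eq_mul, mul_one,
      Complex.norm_natCast]
    linarith
  push_cast at h2
  rw [div_mul_eq_mul_div, le_div_iff₀ hq]
  exact h2

/-- The number of coordinates of `y` equal to `v`. -/
def votes {r : ℕ} {Z : Type*} [DecidableEq Z] (y : Fin r → Z) (v : Z) : ℕ :=
  (Finset.univ.filter fun i => y i = v).card

-- The vote difference is a sum of independent steps. Modulo a large `q` it nearly equidistributes,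
-- so a window of `2 * c + 1` values has proportion at most `2 * (2 * c + 1) / q`.
open Filter in
theorem eventually_card_votes_close_le {Z : Type*} [Fintype Z] [DecidableEq Z] {a b : Z}
    (hab : a ≠ b) (c : ℕ) {ε : ℝ} (hε : 0 < ε) :
    ∀ᶠ r : ℕ in atTop,
      ((Finset.univ.filter fun y : Fin r → Z =>
        |(votes y a : ℤ) - votes y b| ≤ c).card : ℝ) ≤ ε * (Fintype.card Z : ℝ) ^ r := by
  obtain ⟨N, hN⟩ := exists_nat_gt (2 * (2 * c + 1) / ε)
  -- Odd, so that `w a - w b = 2` is a unit.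
  let q := 2 * N + 1
  have : NeZero q := ⟨by simp [q]⟩
  let w : Z → ZMod q := fun z => (if z = a then 1 else 0) - (if z = b then 1 else 0)
  have hw : IsUnit (w a - w b) := by
    have h1 : w a - w b = ((2 : ℕ) : ZMod q) := by
      simp only [w, if_true, if_neg hab, if_neg hab.symm]
      norm_num
    rw [h1, ZMod.isUnit_iff_coprime]
    simp [q]
  have hsum : ∀ {r : ℕ} (y : Fin r → Z), ∑ i, w (y i) = (((votes y a : ℤ) - votes y b : ℤ) : ZMod q) := by
    intro r y
    simp [w, Finset.sum_sub_distrib, votes]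
  filter_upwards [eventually_card_filter_sum_eq_le hw] with r hr
  have hsub : (Finset.univ.filter fun y : Fin r → Z => |(votes y a : ℤ) - votes y b| ≤ c) ⊆
      (Finset.Icc (-c : ℤ) c).biUnion fun t =>
        Finset.univ.filter fun y : Fin r → Z => ∑ i, w (y i) = (t : ZMod q) := by
    intro y hy
    simp only [Finset.mem_filter, Finset.mem_univ, true_and, Finset.mem_biUnion,
      Finset.mem_Icc] at hy ⊢
    exact ⟨_, abs_le.1 hy, hsum y⟩
  have hq : (0 : ℝ) < q := by exact_mod_cast Nat.pos_of_ne_zero (NeZero.ne q)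
  calc ((Finset.univ.filter fun y : Fin r → Z =>
        |(votes y a : ℤ) - votes y b| ≤ c).card : ℝ)
      ≤ ∑ t ∈ Finset.Icc (-c : ℤ) c, ((Finset.univ.filter fun y : Fin r → Z =>
          ∑ i, w (y i) = (t : ZMod q)).card : ℝ) := by
        exact_mod_cast (Finset.card_le_card hsub).trans Finset.card_biUnion_le
    _ ≤ ∑ t ∈ Finset.Icc (-c : ℤ) c, 2 / q * (Fintype.card Z : ℝ) ^ r :=
        Finset.sum_le_sum fun t _ => hr t
    _ = (2 * (2 * c + 1) / q) * (Fintype.card Z : ℝ) ^ r := by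
        have : ((c : ℤ) + 1 - -(c : ℤ)).toNat = 2 * c + 1 := by omega
        rw [Finset.sum_const, Int.card_Icc, this, nsmul_eq_mul]
        push_cast
        ring
    _ ≤ _ := by
        gcongr
        rw [div_lt_iff₀ hε] at hN
        rw [div_le_iff₀ hq]
        simp only [q]
        push_cast
        nlinarith [Nat.cast_nonneg (α := ℝ) N]

theorem votes_le_votes_add {r : ℕ} {Z : Type*} [DecidableEq Z] [AddGroup Z] {y y' : Fin r → Z}
    {u : Z} {c : ℕ} (h : (Finset.univ.filter fun i => y' i ≠ y i + u).card ≤ c) (v : Z) :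
    votes y v ≤ votes y' (v + u) + c ∧ votes y' (v + u) ≤ votes y v + c := by
  constructor
  · refine le_trans ?_ (Nat.add_le_add_left h _)
    refine le_trans (Finset.card_le_card ?_) (Finset.card_union_le _ _)
    intro i
    simp only [Finset.mem_filter, Finset.mem_univ, true_and, Finset.mem_union]
    rintro rfl
    exact em _
  · refine le_trans ?_ (Nat.add_le_add_left h _)
    refine le_trans (Finset.card_le_card ?_) (Finset.card_union_le _ _)
    intro i
    simp only [Finset.mem_filter, Finset.mem_univ, true_and, Finset.mem_union]
    intro hi
    by_cases hy : y' i = y i + u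
    · exact Or.inl (add_right_cancel (hy.symm.trans hi))
    · exact Or.inr hy

open Filter in
/-- A function of many coordinates, equivariant under diagonal translations, which is
insensitive to changing few coordinates of most points. -/
theorem exists_robust_equivariant (Z : Type*) [Fintype Z] [DecidableEq Z] [AddGroup Z] (c : ℕ)
    {ε : ℝ} (hε : 0 < ε) :
    ∃ (r : ℕ) (F : (Fin r → Z) → Z) (B : Finset (Fin r → Z)),
      (B.card : ℝ) ≤ ε * (Fintype.card Z : ℝ) ^ r ∧
      ∀ y ∉ B, ∀ (y' : Fin r → Z) (u : Z),
        (Finset.univ.filter fun i => y' i ≠ y i + u).card ≤ c → F y' = F y + u := by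
  set P := (Finset.univ : Finset (Z × Z)).filter fun p => p.1 ≠ p.2 with P_def
  have hP : (0 : ℝ) < P.card + 1 := by positivity
  have hev : ∀ p ∈ P, ∀ᶠ r : ℕ in atTop, ((Finset.univ.filter fun y : Fin r → Z =>
        |(votes y p.1 : ℤ) - votes y p.2| ≤ (2 * c : ℕ)).card : ℝ) ≤
          ε / (P.card + 1) * (Fintype.card Z : ℝ) ^ r := fun p hp =>
    eventually_card_votes_close_le (Finset.mem_filter.1 hp).2 _ (by positivity)
  obtain ⟨r, hr⟩ := ((eventually_all_finset _).2 hev).exists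
  -- `F` is a plurality winner, with arbitrary tie-breaking. Changing `c` coordinates alters each
  -- count by at most `c`, so the winner can change only if some margin is at most `2 * c`; these
  -- points form the exceptional set.
  have hmax : ∀ y : Fin r → Z, ∃ v, ∀ v', votes y v' ≤ votes y v := fun y => by
    obtain ⟨v, -, hv⟩ := Finset.exists_max_image Finset.univ (votes y) ⟨0, Finset.mem_univ _⟩
    exact ⟨v, fun v' => hv v' (Finset.mem_univ _)⟩
  choose F hF using hmax
  refine ⟨r, F, P.biUnion fun p => Finset.univ.filter fun y : Fin r → Z =>
        |(votes y p.1 : ℤ) - votes y p.2| ≤ (2 * c : ℕ), ?_, ?_⟩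
  · calc _ ≤ ∑ p ∈ P, ((Finset.univ.filter fun y : Fin r → Z =>
        |(votes y p.1 : ℤ) - votes y p.2| ≤ (2 * c : ℕ)).card : ℝ) := by
          exact_mod_cast Finset.card_biUnion_le
      _ ≤ ∑ p ∈ P, ε / (P.card + 1) * (Fintype.card Z : ℝ) ^ r := Finset.sum_le_sum hr
      _ = (P.card * (ε / (P.card + 1))) * (Fintype.card Z : ℝ) ^ r := by
          rw [Finset.sum_const, nsmul_eq_mul, mul_assoc]
      _ ≤ _ := by
          gcongr
          rw [← mul_div_assoc, div_le_iff₀ hP]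
          nlinarith
  · intro y hy y' u hu
    by_contra hne
    set v := F y' - u with v_def
    have hv : F y' = v + u := by simp [v_def]
    have hvne : F y ≠ v := fun h => hne (by rw [hv, h])
    have h1 := (votes_le_votes_add hu (F y)).1
    have h2 := (votes_le_votes_add hu v).2
    have h3 := hF y' (F y + u)
    have h4 := hF y v
    rw [hv] at h3
    apply hy
    simp only [Finset.mem_biUnion, Finset.mem_filter, Finset.mem_univ, true_and]
    refine ⟨(F y, v), Finset.mem_filter.2 ⟨Finset.mem_univ _, hvne⟩, ?_⟩
    rw [abs_le]
    push_cast
    constructor <;> omega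

/-! ### The twisted extension of a finite rotation -/

/-- `ZMod (m * L)` is cut into `m` blocks of length `L`. Offsets at distance `w` from the block ends
absorb an error `e` without changing the block. -/
theorem eq_add_of_mul_add_eq {m L w : ℕ} [NeZero m] {y y' : ZMod m} {ρ ρ' : ℕ} {u e : ℤ}
    (hρ : ρ ∈ Finset.Ico w (L - w)) (hρ' : ρ' ∈ Finset.Ico w (L - w)) (he : |e| ≤ w)
    (h : ((y'.val * L + ρ' : ℕ) : ZMod (m * L)) = (y.val * L + ρ : ℕ) + ((u * L + e : ℤ))) :
    y' = y + u ∧ (ρ' : ℤ) = ρ + e := by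
  rw [Finset.mem_Ico] at hρ hρ'
  rw [abs_le] at he
  have h1 : ((y'.val * L + ρ' : ℤ) : ZMod (m * L)) =
      ((y.val * L + ρ + (u * L + e) : ℤ) : ZMod (m * L)) := by
    push_cast at h ⊢
    exact h
  rw [ZMod.intCast_eq_intCast_iff_dvd_sub] at h1
  obtain ⟨t, ht⟩ := h1
  push_cast at ht
  have h2 : (ρ : ℤ) + e - ρ' = L * (m * t - y.val - u + y'.val) := by linear_combination ht
  have h3 : (ρ : ℤ) + e - ρ' = 0 := by
    refine Int.eq_zero_of_abs_lt_dvd (m := L) ⟨_, h2⟩ ?_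
    rw [abs_lt]
    constructor <;> omega
  have hL : (L : ℤ) ≠ 0 := by omega
  rw [h3, eq_comm, mul_eq_zero, or_iff_right hL] at h2
  refine ⟨?_, by linarith⟩
  have h4 : ((y'.val : ℤ) : ZMod m) = (((y.val : ℤ) + u - m * t : ℤ) : ZMod m) := by
    congr 1
    linarith
  simpa using h4

/-- `A'` consists of the points `(x + F y • g, y * L + ρ)` with `x ∈ A`, `y ∉ B` and `ρ` away from
block ends. If `s ∈ S` returned such a point to `A'`, then `y` would be unchanged and `x' = x + s •
g`. If `s ∈ T` did, then `F y` would grow by `n - 1` while `s • g = n • g`, giving `x' = x + g`,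
excluded by `1 ∈ S`. -/
theorem exists_avoiding_extension {G : Type} [AddCommGroup G] [Fintype G] {g : G} {A : Finset G}
    {S T : Set ℤ} (hA : ∀ s ∈ S, ∀ a ∈ A, a + s • g ∉ A) (h1 : (1 : ℤ) ∈ S) {m : ℕ} [NeZero m]
    (hm : m • g = 0) {r c : ℕ} {F : (Fin r → ZMod m) → ZMod m} {B : Finset (Fin r → ZMod m)}
    (hF : ∀ y ∉ B, ∀ (y' : Fin r → ZMod m) (u : ZMod m),
      (Finset.univ.filter fun i => y' i ≠ y i + u).card ≤ c → F y' = F y + u)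
    {L w : ℕ} {b : Fin r → ℤ} {n : ℤ}
    (hS : ∀ s ∈ S, ∀ i, ∃ e : ℤ, |e| ≤ w ∧ ((s * b i : ℤ) : ZMod (m * L)) = e)
    (hT : ∀ s ∈ T, (m : ℤ) ∣ s - n ∧ ∃ I : Finset (Fin r), Iᶜ.card ≤ c ∧
      ∀ i ∈ I, ∃ e : ℤ, |e| ≤ w ∧
        ((s * b i : ℤ) : ZMod (m * L)) = (((n - 1) * L + e : ℤ) : ZMod (m * L))) :
    ∃ A' : Finset (G × (Fin r → ZMod (m * L))),
      A'.card = A.card * (Bᶜ.card * (L - w - w) ^ r) ∧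
      ∀ s ∈ S ∪ T, ∀ a ∈ A', a + s • (g, fun i => (b i : ZMod (m * L))) ∉ A' := by
  classical
  let l : ZMod m →+ G := ZMod.lift m ⟨zmultiplesHom G g, by simpa using hm⟩
  have hl : ∀ z : ℤ, l z = z • g := fun z => by simp [l]
  let D : Finset (G × (Fin r → ZMod m) × (Fin r → ℕ)) :=
    A ×ˢ Bᶜ ×ˢ Fintype.piFinset fun _ => Finset.Ico w (L - w)
  let Φ : G × (Fin r → ZMod m) × (Fin r → ℕ) → G × (Fin r → ZMod (m * L)) :=
    fun x => (x.1 + l (F x.2.1), fun i => ((x.2.1 i).val * L + x.2.2 i : ℕ))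
  have hD : ∀ x, x ∈ D ↔ x.1 ∈ A ∧ x.2.1 ∉ B ∧ ∀ i, x.2.2 i ∈ Finset.Ico w (L - w) := by
    intro x
    simp only [D, Finset.mem_product, Finset.mem_compl, Fintype.mem_piFinset]
  refine ⟨D.image Φ, ?_, ?_⟩
  · rw [Finset.card_image_of_injOn]
    · simp [D, Finset.card_product, Fintype.card_piFinset]
    · rintro ⟨x, y, ρ⟩ hx ⟨x', y', ρ'⟩ hx' hΦ
      rw [Finset.mem_coe, hD] at hx hx'
      simp only [Φ, Prod.mk.injEq] at hΦ
      have hy : ∀ i, y i = y' i ∧ (ρ i : ℤ) = ρ' i := by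
        intro i
        have := eq_add_of_mul_add_eq (y := y' i) (y' := y i) (u := 0) (e := 0) (hx'.2.2 i)
          (hx.2.2 i) (by simp) (by simpa using congrFun hΦ.2 i)
        simpa using this
      have hyy : y = y' := funext fun i => (hy i).1
      have hρρ : ρ = ρ' := funext fun i => by exact_mod_cast (hy i).2
      subst hyy hρρ
      simpa using hΦ.1
  · intro s hs _ ha has
    obtain ⟨⟨x, y, ρ⟩, hx, rfl⟩ := Finset.mem_image.1 ha
    obtain ⟨⟨x', y', ρ'⟩, hx', hΦ⟩ := Finset.mem_image.1 has
    rw [hD] at hx hx'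
    simp only [Φ, Prod.smul_mk, Prod.mk_add_mk, Prod.mk.injEq] at hΦ
    have hcoord : ∀ i, ((((y' i).val * L + ρ' i : ℕ)) : ZMod (m * L)) =
        (((y i).val * L + ρ i : ℕ)) + ((s * b i : ℤ) : ZMod (m * L)) := by
      intro i
      have : ((((y' i).val * L + ρ' i : ℕ)) : ZMod (m * L)) =
        (((y i).val * L + ρ i : ℕ)) + s • (b i : ZMod (m * L)) := congrFun hΦ.2 i
      rw [this, Int.cast_mul, zsmul_eq_mul]
    rcases hs with hs | hs
    · have hy : y' = y := by
        funext i
        obtain ⟨e, he, hse⟩ := hS s hs i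
        have := (eq_add_of_mul_add_eq (y := y i) (y' := y' i) (u := 0) (e := e) (hx.2.2 i)
          (hx'.2.2 i) he (by rw [hcoord i, hse]; simp)).1
        simpa using this
      subst hy
      refine hA s hs x hx.1 ?_
      have h2 : x' = x + s • g := by
        have := hΦ.1
        rw [add_right_comm] at this
        exact add_right_cancel this
      rw [← h2]
      exact hx'.1
    · obtain ⟨⟨t, ht⟩, I, hI, hIe⟩ := hT s hs
      have hy : F y' = F y + ((n - 1 : ℤ) : ZMod m) := by
        refine hF y hx.2.1 y' _ (le_trans (Finset.card_le_card ?_) hI)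
        intro i hi
        rw [Finset.mem_compl]
        intro hiI
        obtain ⟨e, he, hse⟩ := hIe i hiI
        exact (Finset.mem_filter.1 hi).2 (eq_add_of_mul_add_eq (hx.2.2 i) (hx'.2.2 i) he
          (by rw [hcoord i, hse])).1
      refine hA 1 h1 x hx.1 ?_
      have hsn : s • g = n • g := by
        have : s = n + t * m := by linarith
        rw [this, add_smul, mul_smul, natCast_zsmul, hm, smul_zero, add_zero]
      have h2 : x' = x + (1 : ℤ) • g := by
        have h3 := hΦ.1
        rw [hy, map_add, hl, hsn, sub_smul] at h3
        have h4 : x' = (x' + (l (F y) + (n • g - (1 : ℤ) • g))) - (l (F y) + (n • g - (1 : ℤ) • g)) := by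
          abel
        rw [h4, h3]
        abel
      rw [← h2]
      exact hx'.1

/-! ### Choice of parameters and the inductive step -/

theorem exists_small_linearIndependent (r : ℕ) {C : ℝ} (hC : 0 < C) :
    ∃ α : Fin r → ℝ, LinearIndependent ℚ α ∧ ∀ i, |α i| < C := by
  have : Infinite (Module.Free.ChooseBasisIndex ℚ ℝ) := by
    rw [Cardinal.infinite_iff, ← Module.Free.rank_eq_card_chooseBasisIndex, Real.rank_rat_real]
    exact Cardinal.aleph0_le_continuum
  let f : Fin r → Module.Free.ChooseBasisIndex ℚ ℝ := fun i => Infinite.natEmbedding _ i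
  have hf : Function.Injective f := (Infinite.natEmbedding _).injective.comp Fin.val_injective
  have hli := (Module.Free.chooseBasis ℚ ℝ).linearIndependent.comp f hf
  set v := (Module.Free.chooseBasis ℚ ℝ) ∘ f with v_def
  choose N hN using fun i => exists_nat_gt (|v i| / C)
  have hN' : ∀ i, ((N i : ℚ) + 1)⁻¹ ≠ 0 := fun i => by positivity
  refine ⟨_, hli.units_smul fun i => Units.mk0 _ (hN' i), fun i => ?_⟩
  have hp : (0 : ℝ) < N i + 1 := by positivity
  have h1 := hN i
  rw [div_lt_iff₀ hC] at h1
  simp only [Pi.smul_apply', Units.smul_mk0, Rat.smul_def]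
  push_cast
  rw [abs_mul, abs_inv, abs_of_pos hp, inv_mul_lt_iff₀ hp]
  linarith

/-- Compactness of the torus of frequencies. Finiteness of `T` is what later bounds its elements and
lets `L` be chosen. -/
theorem exists_finite_approx {k : ℕ} {P : ℤ → Prop} {η : ℝ}
    (h : ∀ β : Fin k → UnitAddCircle, ∃ s, P s ∧ ∀ j, ‖s • β j‖ < η) :
    ∃ T : Finset ℤ, (∀ s ∈ T, P s) ∧
      ∀ β : Fin k → UnitAddCircle, ∃ s ∈ T, ∀ j, ‖s • β j‖ < η := by
  classical
  obtain ⟨t, ht⟩ := isCompact_univ.elim_finite_subcover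
    (fun s : {s // P s} => {β : Fin k → UnitAddCircle | ∀ j, ‖(s : ℤ) • β j‖ < η})
    (fun s => by
      have : {β : Fin k → UnitAddCircle | ∀ j, ‖(s : ℤ) • β j‖ < η} =
          ⋂ j, {β : Fin k → UnitAddCircle | ‖(s : ℤ) • β j‖ < η} := by
        ext β
        simp
      rw [this]
      exact isOpen_iInter_of_finite fun j => isOpen_lt (by fun_prop) continuous_const)
    (fun β _ => by
      obtain ⟨s, hs, hβ⟩ := h β
      exact Set.mem_iUnion.2 ⟨⟨s, hs⟩, hβ⟩)
  refine ⟨t.image Subtype.val, fun s hs => ?_, fun β => ?_⟩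
  · obtain ⟨s, -, rfl⟩ := Finset.mem_image.1 hs
    exact s.2
  · obtain ⟨s, hs, hβ⟩ := Set.mem_iUnion₂.1 (ht (Set.mem_univ β))
    exact ⟨s, Finset.mem_image_of_mem _ hs, hβ⟩

/-- Scaling by `m * L` turns the approximation error into at most `B + 1`, and rounding `α * (m *
L)` costs at most `B` after multiplication by `s`. The resulting margin is a fraction `2 / K` of a
block, whatever `B` is. -/
theorem exists_intCast_eq_of_abs_sub_lt {m L K B : ℕ} (hm : 0 < m) (hK : 0 < K)
    (hL : L = K * (B + 1)) {s v z : ℤ}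
    {α : ℝ} (hs : |s| ≤ B) (h : |s * α - v / m - z| < 1 / (m * K)) :
    ∃ e : ℤ, |e| ≤ (2 * (B + 1) : ℕ) ∧
      ((s * round (α * (m * L)) : ℤ) : ZMod (m * L)) = ((v * L + e : ℤ) : ZMod (m * L)) := by
  have hm' : (0 : ℝ) < m := by exact_mod_cast hm
  have hK' : (0 : ℝ) < K := by exact_mod_cast hK
  refine ⟨s * round (α * (m * L)) - v * L - z * (m * L), ?_, ?_⟩
  · have h1 : |(s * α - v / m - z) * (m * L)| ≤ B + 1 := by
      have hL' : (m : ℝ) * L = m * K * (B + 1) := by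
        rw [hL]
        push_cast
        ring
      rw [abs_mul, hL', abs_of_nonneg (by positivity : (0 : ℝ) ≤ m * K * (B + 1))]
      calc _ ≤ 1 / (m * K) * ((m : ℝ) * K * (B + 1)) := by gcongr
        _ = _ := by field_simp
    have h2 : |(s : ℝ) * (α * (m * L) - round (α * (m * L)))| ≤ B := by
      rw [abs_mul]
      have h3 : |(s : ℝ)| ≤ B := by exact_mod_cast hs
      calc _ ≤ |(s : ℝ)| * 1 := by
            gcongr
            exact (abs_sub_round _).trans (by norm_num)
        _ ≤ _ := by rwa [mul_one]
    have h4 : ((s * round (α * (m * L)) - v * L - z * (m * L) : ℤ) : ℝ) =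
        (s * α - v / m - z) * (m * L) - s * (α * (m * L) - round (α * (m * L))) := by
      push_cast
      field_simp
      ring
    have h5 : |((s * round (α * (m * L)) - v * L - z * (m * L) : ℤ) : ℝ)| ≤ 2 * (B + 1) := by
      rw [h4]
      refine (abs_sub _ _).trans ?_
      linarith
    exact_mod_cast h5
  · have : ((z * (m * L) : ℤ) : ZMod (m * L)) = 0 := by
      rw [ZMod.intCast_zmod_eq_zero_iff_dvd]
      exact ⟨z, by push_cast; ring⟩
    have h2 : s * round (α * (m * L)) = v * L + (s * round (α * (m * L)) - v * L - z * (m * L)) +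
      z * (m * L) := by ring
    conv_lhs => rw [h2]
    rw [Int.cast_add, this, add_zero]

theorem AvoidableWithDensity.exists_union {d : ℝ} (hd : 0 ≤ d) {S : Finset ℤ} (h1 : (1 : ℤ) ∈ S)
    (hS : AvoidableWithDensity d S) (n : ℤ) (k : ℕ) {η : ℝ} (hη : 0 < η) :
    ∃ T : Finset ℤ, AvoidableWithDensity d (S ∪ T : Set ℤ) ∧
      ∀ β : Fin k → UnitAddCircle, ∃ s ∈ T, ∀ j, ‖(s - n) • β j‖ < η := by
  classical
  obtain ⟨G, _, _, g, A, hdA, hA⟩ := hS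
  set m := Fintype.card G with m_def
  have hm : 0 < m := Fintype.card_pos
  have : NeZero m := ⟨hm.ne'⟩
  have hm' : (0 : ℝ) < m := by exact_mod_cast hm
  -- The extension costs two factors `1 - ε`, one for `B` and one for block margins; a quarter of
  -- the slack leaves the density above `d`.
  set ε : ℝ := (A.card / m - d) / 4 with ε_def
  have hε : 0 < ε := by
    have : d < A.card / m := by rwa [lt_div_iff₀ hm']
    rw [ε_def]
    linarith
  have hA1 : (A.card : ℝ) / m ≤ 1 := by
    rw [div_le_one hm']
    exact_mod_cast Finset.card_le_univ A
  obtain ⟨r, F, B, hB, hF⟩ := exists_robust_equivariant (ZMod m) (k + 1) hε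
  rw [ZMod.card] at hB
  obtain ⟨K, hK⟩ := exists_nat_gt (4 * r / ε + 4)
  have hKpos : (0 : ℝ) < K := lt_of_le_of_lt (by positivity) hK
  have hK4 : 4 ≤ K := by
    have : (4 : ℝ) < K := lt_of_le_of_lt (by linarith [show 0 ≤ 4 * r / ε by positivity]) hK
    exact_mod_cast this.le
  have hKr : 4 * r / K ≤ ε := by
    rw [div_le_iff₀ hKpos, ← div_le_iff₀' hε]
    linarith
  set δ : ℝ := 1 / (m * K) with δ_def
  have hδ : 0 < δ := by positivity
  have hbound : ∀ U : Finset ℤ, ∃ b : ℕ, ∀ s ∈ U, |s| ≤ b := fun U =>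
    ⟨U.sup Int.natAbs, fun s hs => by
      rw [Int.abs_eq_natAbs]
      exact_mod_cast Finset.le_sup (f := Int.natAbs) hs⟩
  obtain ⟨b₀, hb₀⟩ := hbound S
  -- So small that `|s * α i| < δ` for all `s ∈ S`: the old elements do not move digits.
  obtain ⟨α, hα, hαC⟩ := exists_small_linearIndependent r
    (C := δ / (b₀ + 1)) (by positivity)
  -- The target is chosen so that `(n + m * s) * α i` is close to `(n - 1) / m` modulo `1`, a shift
  -- by `n - 1` blocks.
  obtain ⟨T₀, hT₀, hT₀β⟩ := exists_finite_approx (k := k) (η := η)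
    (P := fun t => ∃ s : ℤ, t = m * s ∧ ∃ I : Finset (Fin r), Iᶜ.card ≤ k + 1 ∧
      ∀ i ∈ I, ‖((m * s * α i : ℝ) : UnitAddCircle) -
        (((n - 1 : ℤ) / m - n * α i : ℝ) : UnitAddCircle)‖ < δ) (fun β => by
    obtain ⟨s, I, hI, hIα, hβ⟩ := exists_int_approx_off_few_coordinates hm hα
      (fun i => (((n - 1 : ℤ) / m - n * α i : ℝ) : UnitAddCircle)) β (lt_min hδ hη)
    exact ⟨m * s, ⟨s, rfl, I, hI, fun i hi => (hIα i hi).trans_le (min_le_left _ _)⟩,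
      fun j => (hβ j).trans_le (min_le_right _ _)⟩)
  set T := T₀.image fun t => n + t with T_def
  refine ⟨T, ?_, fun β => ?_⟩
  swap
  · obtain ⟨t, ht, hβ⟩ := hT₀β β
    exact ⟨n + t, Finset.mem_image_of_mem _ ht, by simpa using hβ⟩
  obtain ⟨b, hb⟩ := hbound (S ∪ T)
  set L := K * (b + 1) with L_def
  set w := 2 * (b + 1) with w_def
  have hL : 0 < L := by positivity
  have : NeZero (m * L) := ⟨by positivity⟩
  obtain ⟨A', hA'card, hA'⟩ := exists_avoiding_extension (m := m) (S := S) (T := T) hA h1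
    (card_nsmul_eq_zero : m • g = 0) hF (L := L) (w := w) (b := fun i => round (α i * (m * L)))
    (n := n)
    (fun s hs i => by
      have hsα : |s * α i - (0 : ℤ) / m - (0 : ℤ)| < 1 / (m * K) := by
        have h2 : |(s : ℝ)| ≤ b₀ := by exact_mod_cast hb₀ s hs
        have h3 := hαC i
        rw [lt_div_iff₀ (by positivity)] at h3
        rw [Int.cast_zero, zero_div, sub_zero, sub_zero, abs_mul]
        nlinarith [abs_nonneg (α i)]
      obtain ⟨e, he, hse⟩ := exists_intCast_eq_of_abs_sub_lt hm (by omega) L_def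
        (hb s (Finset.mem_union_left _ hs)) hsα
      exact ⟨e, he, by rw [hse]; simp⟩)
    (fun s hs => by
      obtain ⟨t, ht, rfl⟩ := Finset.mem_image.1 hs
      obtain ⟨s', rfl, I, hI, hIα⟩ := hT₀ t ht
      refine ⟨⟨s', by ring⟩, I, hI, fun i hi => ?_⟩
      have h2 := hIα i hi
      rw [← AddCircle.coe_sub, UnitAddCircle.norm_eq] at h2
      refine exists_intCast_eq_of_abs_sub_lt hm (by omega) L_def
        (z := round ((m * s' * α i : ℝ) - ((n - 1 : ℤ) / m - n * α i)))
        (hb _ (Finset.mem_union_right _ hs)) (lt_of_eq_of_lt ?_ h2)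
      congr 1
      push_cast
      ring)
  refine ⟨G × (Fin r → ZMod (m * L)), inferInstance, inferInstance, _, A', ?_, hA'⟩
  -- Two margins of `2 * (b + 1)` out of `L = K * (b + 1)`. The lost fraction does not involve `b`,
  -- so `K` could be fixed before `T`.
  have hLw : ((L - w - w : ℕ) : ℝ) = (1 - 4 / K) * L := by
    have : L - w - w = (K - 4) * (b + 1) := by
      rw [L_def, w_def, Nat.sub_mul]
      omega
    rw [this, L_def]
    push_cast [Nat.cast_sub hK4]
    field_simp
  have hK1 : (4 : ℝ) / K ≤ 1 := by
    rw [div_le_one hKpos]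
    exact_mod_cast hK4
  have hbern : 1 - ε ≤ (1 - 4 / (K : ℝ)) ^ r := by
    have := one_add_mul_le_pow (a := -(4 / (K : ℝ))) (by linarith) r
    rw [← sub_eq_add_neg] at this
    refine le_trans ?_ this
    have : (r : ℝ) * -(4 / K) = - (4 * r / K) := by ring
    linarith
  have hBc : (1 - ε) * (m : ℝ) ^ r ≤ Bᶜ.card := by
    rw [Finset.card_compl, Nat.cast_sub (Finset.card_le_univ _)]
    simp only [Fintype.card_pi, ZMod.card, Finset.prod_const, Finset.card_univ, Fintype.card_fin]
    push_cast
    linarith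
  have hε1 : 0 ≤ 1 - ε := by
    rw [ε_def]
    linarith
  have hmain : d < A.card / m * ((1 - ε) * (1 - ε)) := by
    have h2 : (A.card : ℝ) / m = d + 4 * ε := by
      rw [ε_def]
      ring
    have h3 : 0 ≤ (A.card : ℝ) / m * ε ^ 2 :=
      mul_nonneg (div_nonneg (Nat.cast_nonneg _) hm'.le) (sq_nonneg ε)
    nlinarith [mul_nonneg hε.le (sub_nonneg.2 hA1)]
  rw [hA'card]
  simp only [Fintype.card_prod, Fintype.card_pi, ZMod.card, Finset.prod_const, Finset.card_univ,
    Fintype.card_fin, ← m_def]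
  push_cast
  rw [hLw]
  have hpos : (0 : ℝ) < m * (m * L) ^ r := by
    have : (0 : ℝ) < L := by exact_mod_cast hL
    positivity
  calc d * (m * (m * L : ℝ) ^ r) < A.card / m * ((1 - ε) * (1 - ε)) * (m * (m * L : ℝ) ^ r) := by
        gcongr
    _ = A.card * (((1 - ε) * (m : ℝ) ^ r) * ((1 - ε) * (L : ℝ) ^ r)) := by
        rw [mul_pow]
        field_simp
    _ ≤ A.card * (Bᶜ.card * ((1 - 4 / K) * L) ^ r) := by
        rw [mul_pow _ (L : ℝ)]
        gcongr

/-! ### Bohr density and conclusion -/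

theorem exists_finite_homs_of_mem_bohr_nhds {n : ℤ} {B : Set ℤ} (h : IsBohrNhd B n) :
    ∃ (k : ℕ) (β : Fin k → UnitAddCircle) (η : ℝ), 0 < η ∧
      ∀ s : ℤ, (∀ j, ‖(s - n) • β j‖ < η) → s ∈ B := by
  classical
  rw [IsBohrNhd, nhds_iInf, Filter.mem_iInf] at h
  obtain ⟨I, hI, V, hV, rfl⟩ := h
  have := hI.to_subtype
  have hη : ∀ i : I, ∀ᶠ η in nhdsWithin (0 : ℝ) (Set.Ioi 0),
      ∀ s : ℤ, ‖(s - n) • i.1 1‖ < η → s ∈ V i := by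
    intro i
    have h1 := hV i
    rw [nhds_induced, Filter.mem_comap] at h1
    obtain ⟨W, hW, hWV⟩ := h1
    obtain ⟨η₀, hη₀, hball⟩ := Metric.mem_nhds_iff.1 hW
    filter_upwards [Ioo_mem_nhdsGT hη₀] with η hη s hs
    refine hWV (hball ?_)
    rw [Metric.mem_ball, dist_eq_norm, ← map_sub]
    have h2 : i.1 (s - n) = (s - n) • i.1 1 := by
      rw [← map_zsmul, smul_eq_mul, mul_one]
    rw [h2]
    exact hs.trans hη.2
  obtain ⟨η, hη, hpos⟩ := ((Filter.eventually_all.2 hη).and self_mem_nhdsWithin).exists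
  have := Fintype.ofFinite I
  refine ⟨Fintype.card I, fun j => ((Fintype.equivFin I).symm j).1 1, η, hpos, fun s hs => ?_⟩
  refine Set.mem_iInter.2 fun i => hη i s ?_
  simpa using hs (Fintype.equivFin I i)

/-- All pairs of a centre and a rank are treated in turn, rank `k` with radius `1 / (k + 1)`. The
same `d` serves at every stage because avoidability is a strict inequality. -/
theorem exists_bohrDense_avoidable {d : ℝ} (hd : 0 ≤ d) (hd' : d < 1 / 2) :
    ∃ S : ℕ → Set ℤ, Monotone S ∧ (∀ j, AvoidableWithDensity d (S j)) ∧ BohrDense (⋃ j, S j) := by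
  classical
  -- The even residue in `ZMod 2` avoids `1` with density `1 / 2`; this is the source of the
  -- constant.
  have hstart : AvoidableWithDensity d (({1} : Finset ℤ) : Set ℤ) := by
    refine ⟨ZMod 2, inferInstance, inferInstance, 1, {0}, ?_, ?_⟩
    · rw [ZMod.card, Finset.card_singleton]
      norm_num
      linarith
    · simp
  choose T hT hTβ using fun (S : {S : Finset ℤ // (1 : ℤ) ∈ S ∧ AvoidableWithDensity d S})
    (p : ℤ × ℕ) => S.2.2.exists_union hd S.2.1 p.1 p.2 (η := 1 / (p.2 + 1)) (by positivity)
  obtain ⟨p, hp⟩ := exists_surjective_nat (ℤ × ℕ)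
  let Q : ℕ → {S : Finset ℤ // (1 : ℤ) ∈ S ∧ AvoidableWithDensity d S} := fun j =>
    Nat.rec ⟨{1}, by simp, hstart⟩
      (fun j S => ⟨S.1 ∪ T S (p j), Finset.mem_union_left _ S.2.1, by
        rw [Finset.coe_union]; exact hT S (p j)⟩) j
  have hQ : ∀ j, (Q (j + 1)).1 = (Q j).1 ∪ T (Q j) (p j) := fun j => rfl
  refine ⟨fun j => (Q j).1, monotone_nat_of_le_succ fun j => ?_, fun j => (Q j).2.2, ?_⟩
  · simp only [hQ]
    exact_mod_cast Finset.subset_union_left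
  · intro n
    refine (@mem_closure_iff_nhds ℤ bohrTopology _ _).2 ?_
    intro B hB
    obtain ⟨k, β, η, hη, hβ⟩ := exists_finite_homs_of_mem_bohr_nhds hB
    obtain ⟨N, hN⟩ := exists_nat_gt (1 / η)
    -- Rank `k + N` both accommodates the `k` frequencies, padded by zeros, and makes the radius
    -- less than `η`.
    obtain ⟨j, hj⟩ := hp (n, k + N)
    obtain ⟨s, hs, hsβ⟩ := hTβ (Q j) (p j) (fun i => if hi : i.1 < k then β ⟨i, hi⟩ else 0)
    rw [hj] at hsβ
    refine ⟨s, hβ s fun i => ?_, Set.mem_iUnion.2 ⟨j + 1, ?_⟩⟩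
    · have h1 := hsβ ⟨i, by omega⟩
      simp only [Fin.is_lt, dif_pos, Fin.eta] at h1
      refine h1.trans_le ?_
      rw [div_le_iff₀ (by positivity)]
      rw [div_lt_iff₀ hη] at hN
      push_cast
      nlinarith [Nat.cast_nonneg (α := ℝ) k]
    · rw [hQ]
      exact Finset.mem_coe.2 (Finset.mem_union_right _ hs)

theorem exists_bohrDense_disjoint_sub {ε : ℝ} (hε : 0 < ε) :
    ∃ S A : Set ℤ, BohrDense S ∧ 1 / 2 - ε < upperBanachDensity A ∧ (A - A) ∩ S = ∅ := by
  obtain ⟨d, hd1, hd2⟩ := exists_between (max_lt (by linarith : 1 / 2 - ε < 1 / 2) one_half_pos)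
  obtain ⟨S, hS, hav, hdense⟩ :=
    exists_bohrDense_avoidable ((le_max_right _ _).trans hd1.le) hd2
  obtain ⟨A, hA, hAd⟩ := exists_set_of_monotone_avoidable hS hav
  refine ⟨_, A, hdense, ((le_max_left _ _).trans_lt hd1).trans_le (le_upperBanachDensity hAd), ?_⟩
  refine Set.eq_empty_of_forall_notMem ?_
  rintro _ ⟨⟨a, ha, b, hb, rfl⟩, hs⟩
  exact hA _ hs b hb (by simpa using ha)

theorem theorem1p1 :
    (∀ ε : ℝ, 0 < ε →
      ∃ S A : Set ℤ,
        BohrDense S ∧ 1 / 2 - ε < upperBanachDensity A ∧ (A - A) ∩ S = ∅) ∧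
    (∃ A : Set ℤ,
      0 < upperBanachDensity A ∧
        ∀ (n : ℤ) (B : Set ℤ), IsBohrNhd B n → ¬ B ⊆ A - A) := by
  refine ⟨fun ε hε => exists_bohrDense_disjoint_sub hε, ?_⟩
  obtain ⟨S, A, hS, hA, hAS⟩ := exists_bohrDense_disjoint_sub (ε := 1 / 4) (by norm_num)
  refine ⟨A, by linarith, fun n B hB hBA => ?_⟩
  obtain ⟨s, hsB, hsS⟩ := (@mem_closure_iff_nhds ℤ bohrTopology _ _).1 (hS n) B hB
  exact (hAS ▸ (⟨hBA hsB, hsS⟩ : s ∈ (A - A) ∩ S) : s ∈ (∅ : Set ℤ))
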